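/- Write $\mathbb N=\{0,1,2,\dots\}$, $\langle j\rangle=\max\{1,|j|\}$, $\mathbb T^\infty=(\mathbb R/\mathbb Z)^{\mathbb N}$ with the product of the Haar probability measures, and let $\mathbb Z^\infty_*$ be the set of finitely supported $k\in\mathbb Z^{\mathbb N}$. Fix an integer $\eta\ge 2$ and put $|k|_\eta=\sum_j\langle j\rangle^\eta|k_j|$ for $k\in\mathbb Z^\infty_*$. Let $\mu>1$ and $\gamma>0$ be real, let $m\ge 2$ be an integer, and let $w:[0,1]\to\mathbb R$ be a $\mathcal C_0^m$ weighting function: $w\in C^m([0,1])$, $w^{(i)}(0)=w^{(i)}(1)=0$ for $0\le i\le m$, $w>0$ on $(0,1)$, and $\int_0^1 w(s)\,ds=1$. Let $\mathcal B$ be a complex Banach space and let $\tilde\Delta_\infty:[1,\infty)\to[1,\infty)$ be an approximation function, i.e. continuous, strictly increasing and unbounded. Let $f:\mathbb T^\infty\to\mathcal B$ be integrable, put $\hat f_k=\int_{\mathbb T^\infty}f(\hat\theta)e^{-2\pi i k\cdot\hat\theta}\,d\hat\theta$, and assume that $f\in\mathcal B_{\tilde\Delta_\infty}$, that is, $f(\theta)=\sum_{k\in\mathbb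 Z^\infty_*}\hat f_k e^{2\pi i k\cdot\theta}$ for every $\theta$ (unconditional convergence in the norm of $\mathcal B$) and $\sup_{0\ne k\in\mathbb Z^\infty_*}\tilde\Delta_\infty(|k|_\eta)\|\hat f_k\|_{\mathcal B}<\infty$. Assume moreover that $f$ is analytic in some neighbourhood of $\mathbb T^\infty$ in $\mathbb C^{\mathbb N}$: for some $\sigma>0$ there is a function $F$ on $\{z\in\mathbb C^{\mathbb N}:|\operatorname{Im}z_j|<\sigma\langle j\rangle^\eta\text{ for all }j\}$ with values in $\mathcal B$, continuous for the product topology and holomorphic in each variable $z_j$ separately, with $F(x)=f(x\bmod 1)$ for every $x\in\mathbb R^{\mathbb N}$. Then there is a constant $C_3>0$, depending only on $f,\tilde\Delta_\infty,\eta,\mu,w,\gamma,m$, such that both of the following hold. 1. (Discrete case.) If $\rho\in\mathbb R^{\mathbb N}$ satisfies $$|k\cdot\rho-n|>\frac{\gamma}{\prod_{j\in\mathbb N}\bigl(1+|k_j|^\mu\langle j\rangle^\mu\bigr)}\qquad\text{for all }0\ne k\in\mathbb Z^\infty_*\text{ and all }n\in\mathbb Z,$$ then for all integers $N\ge 1$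 and all $\theta\in\mathbb T^\infty$ $$\Bigl\|\frac1{A_N}\sum_{n=0}^{N-1}w\Bigl(\frac nN\Bigr)f(\theta+n\rho)-\int_{\mathbb T^\infty}f(\hat\theta)\,d\hat\theta\Bigr\|_{\mathcal B}\le\frac{C_3}{N^m},\qquad A_N=\sum_{n=0}^{N-1}w\Bigl(\frac nN\Bigr),$$ where for $N=1$, in which case $A_1=w(0)=0$, the average is read as $0$. 2. (Continuous case.) If $\rho\in\mathbb R^{\mathbb N}$ satisfies $$|k\cdot\rho|>\frac{\gamma}{\prod_{j\in\mathbb N}\bigl(1+|k_j|^\mu\langle j\rangle^\mu\bigr)}\qquad\text{for all }0\ne k\in\mathbb Z^\infty_*$$ (in particular if $\rho$ is as in 1), then for all real $T\ge 1$ and all $\theta\in\mathbb T^\infty$ $$\Bigl\|\frac1T\int_0^T w\Bigl(\frac tT\Bigr)f(\rho t+\theta)\,dt-\int_{\mathbb T^\infty}f(\hat\theta)\,d\hat\theta\Bigr\|_{\mathcal B}\le\frac{C_3}{T^m}.$$ In particular, if $w$ is a $\mathcal C_0^\infty$ weighting function, i.e. the above holds for every $m$, both averages converge at an arbitrary polynomial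 rate. -/

import Mathlib

open MeasureTheory Filter Topology
open scoped BigOperators ContDiff

namespace AlmostPeriodic

noncomputable section

/-- An approximation function `Δ : [1, ∞) → [1, ∞)`: continuous, strictly increasing and
unbounded (the values of `Δ` outside `[1, ∞)` play no role). -/
structure IsApproximationFunction (Δ : ℝ → ℝ) : Prop where
  mapsTo : Set.MapsTo Δ (Set.Ici 1) (Set.Ici 1)
  continuousOn : ContinuousOn Δ (Set.Ici 1)
  strictMonoOn : StrictMonoOn Δ (Set.Ici 1)
  tendsto : Tendsto Δ atTop atTop

/-- A `C_0^m([0,1])` weighting function (only its values on `[0,1]` are used): it is `C^m` on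
`[0,1]`, its derivatives of order `0, …, m` vanish at both end points, it is positive on `(0,1)`
and it has integral one. -/
structure IsWeight (m : ℕ) (w : ℝ → ℝ) : Prop where
  contDiffOn : ContDiffOn ℝ m w (Set.Icc 0 1)
  deriv_zero : ∀ k ≤ m, iteratedDerivWithin k w (Set.Icc 0 1) 0 = 0
  deriv_one : ∀ k ≤ m, iteratedDerivWithin k w (Set.Icc 0 1) 1 = 0
  pos : ∀ x ∈ Set.Ioo (0 : ℝ) 1, 0 < w x
  integral_eq_one : ∫ s in (0 : ℝ)..1, w s = 1

/-- The infinite-dimensional torus `𝕋^∞ = (ℝ/ℤ)^ℕ`. -/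
abbrev Torus : Type := ℕ → UnitAddCircle

/-- The product of the Haar probability measures of the circles `ℝ/ℤ`. -/
def torusMeasure : Measure Torus :=
  Measure.infinitePi fun _ : ℕ => (AddCircle.haarAddCircle : Measure UnitAddCircle)

/-- The class in `𝕋^∞` of a vector of real numbers. -/
def toTorus (x : ℕ → ℝ) : Torus := fun j => (x j : UnitAddCircle)

/-- `⟨j⟩ = max {1, |j|}`. -/
def bracket (j : ℕ) : ℝ := max 1 (j : ℝ)

/-- `|k|_η = ∑_j ⟨j⟩^η |k_j|`. For integer vectors this is finite exactly when `k` has finite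
support, so that the lattice `ℤ_*^∞` is the type `ℕ →₀ ℤ`. -/
def etaNorm (η : ℕ) (k : ℕ →₀ ℤ) : ℝ := k.sum fun j n => bracket j ^ η * |(n : ℝ)|

/-- `k · ρ = ∑_j k_j ρ_j`. -/
def pairing (k : ℕ →₀ ℤ) (ρ : ℕ → ℝ) : ℝ := k.sum fun j n => (n : ℝ) * ρ j

/-- `∏_j (1 + |k_j|^μ ⟨j⟩^μ)`; the factors with `k_j = 0` are equal to one when `μ ≠ 0`. -/
def bourgainDenominator (μ : ℝ) (k : ℕ →₀ ℤ) : ℝ :=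
  k.prod fun j n => 1 + |(n : ℝ)| ^ μ * bracket j ^ μ

/-- The infinite-dimensional Diophantine condition, discrete case. -/
def IsDiophantine (γ μ : ℝ) (ρ : ℕ → ℝ) : Prop :=
  ∀ k : ℕ →₀ ℤ, k ≠ 0 → ∀ n : ℤ, γ / bourgainDenominator μ k < |pairing k ρ - n|

/-- The infinite-dimensional Diophantine condition, continuous case. -/
def IsDiophantineFlow (γ μ : ℝ) (ρ : ℕ → ℝ) : Prop :=
  ∀ k : ℕ →₀ ℤ, k ≠ 0 → γ / bourgainDenominator μ k < |pairing k ρ|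

/-- The character `θ ↦ e^{2πi k·θ}` of `𝕋^∞`. -/
def character (k : ℕ →₀ ℤ) (θ : Torus) : ℂ := k.prod fun j n => (fourier n (θ j) : ℂ)

section BanachValued

variable {E : Type*} [NormedAddCommGroup E] [NormedSpace ℂ E]

/-- The Fourier coefficient `∫ f(θ) e^{-2πi k·θ} dθ`. -/
def fourierCoefficient (f : Torus → E) (k : ℕ →₀ ℤ) : E :=
  ∫ θ, character (-k) θ • f θ ∂torusMeasure

/-- The space of functions that are the sum of their Fourier series and whose Fourier coefficients
satisfy `sup_{k ≠ 0} Δ(|k|_η) ‖f̂_k‖ < ∞`. -/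
structure MemB (η : ℕ) (Δ : ℝ → ℝ) (f : Torus → E) : Prop where
  integrable : Integrable f torusMeasure
  hasSum : ∀ θ : Torus, HasSum (fun k : ℕ →₀ ℤ => character k θ • fourierCoefficient f k) (f θ)
  decay : ∃ M : ℝ, ∀ k : ℕ →₀ ℤ, k ≠ 0 → Δ (etaNorm η k) * ‖fourierCoefficient f k‖ ≤ M

/-- The neighbourhood `{z : |Im z_j| < σ ⟨j⟩^η for all j}` of the real vectors in `ℂ^ℕ` that
belongs to the metric `|·|_η` (the thickened torus, lifted to `ℂ^ℕ`). -/
def tube (η : ℕ) (σ : ℝ) : Set (ℕ → ℂ) := {z | ∀ j, |(z j).im| < σ * bracket j ^ η}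

/-- `f` is analytic in a neighbourhood of `𝕋^∞` in `ℂ^ℕ`: on some tube there is a function `F`,
continuous and holomorphic in each variable, that agrees with `f` at the real points. -/
def IsAnalyticNearTorus (η : ℕ) (f : Torus → E) : Prop :=
  ∃ σ : ℝ, 0 < σ ∧ ∃ F : (ℕ → ℂ) → E,
    ContinuousOn F (tube η σ) ∧
    (∀ z ∈ tube η σ, ∀ j : ℕ, DifferentiableAt ℂ (fun s : ℂ => F (Function.update z j s)) (z j)) ∧
    ∀ x : ℕ → ℝ, F (fun j => (x j : ℂ)) = f (toTorus x)

/-- The rotation `T_ρ(θ) = θ + ρ mod 1`. -/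
def rotation (ρ : ℕ → ℝ) (θ : Torus) : Torus := θ + toTorus ρ

/-- The weighted Birkhoff average
`WB_N(f)(θ) = A_N⁻¹ ∑_{n < N} w(n/N) f(T_ρ^n θ)`, `A_N = ∑_{n < N} w(n/N)`.
For `N = 1` one has `A_1 = w(0) = 0`, and the average is read as `0`. -/
def weightedBirkhoff (w : ℝ → ℝ) (ρ : ℕ → ℝ) (N : ℕ) (f : Torus → E) (θ : Torus) : E :=
  ((∑ n ∈ Finset.range N, w ((n : ℝ) / N) : ℝ) : ℂ)⁻¹ •
    ∑ n ∈ Finset.range N, (w ((n : ℝ) / N) : ℂ) • f ((rotation ρ)^[n] θ)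

/-- The weighted average `T⁻¹ ∫_0^T w(t/T) f(ρ t + θ) dt` along the linear flow. -/
def weightedFlowAverage (w : ℝ → ℝ) (ρ : ℕ → ℝ) (T : ℝ) (f : Torus → E) (θ : Torus) : E :=
  (T : ℂ)⁻¹ • ∫ t in (0 : ℝ)..T, (w (t / T) : ℂ) • f (toTorus (fun j => ρ j * t) + θ)

end BanachValued

end

end AlmostPeriodic

/-! Averaging acts on the Fourier series of `f` as a multiplier: the mode `k` is multiplied by a
weighted mean of `e^{2πi n k·ρ}` (or of `e^{2πi t k·ρ}`), and the mode `k = 0` is reproduced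
exactly. It remains to bound the multipliers and to sum the bounds.

Since `w` vanishes at both ends together with its derivatives up to order `m`, parts can be taken
`m` times without boundary terms. In the discrete case each step gains `1/N` from a difference of
`w` and loses one small divisor `|e^{-2πi k·ρ} - 1|`. About `N` terms remain, and they are offset by
`A_N ≥ cN` (`norm_sum_le`, `exists_le_sum`). In the continuous case each step gains `1/(T|k·ρ|)`
(`norm_integral_le`). With the Diophantine condition the multiplier is at most a constant times
`(D(k)/γ)^m N^{-m}`, or the same with `T`, where `D(k)` is `bourgainDenominator μ k`.

What is left is the finiteness of `∑ ‖f̂_k‖ D(k)^m`, which involves no `ρ`. Shifting the contour in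
the finitely many variables on the support of `k` gives `‖f̂_k‖ ≤ M e^{-a|k|_η}`
(`exists_norm_fourierCoefficient_le`). Both `e^{-a|k|_η}` and `D(k)` are products over the
coordinates, so the sum over the infinite-dimensional lattice is bounded by a product `∏_j (1 +
ε_j)` with `∑ ε_j < ∞` (`summable_finsupp_prod`, `summable_exp_neg_etaNorm_mul_pow`). -/

namespace AlmostPeriodic

/-! ### Weights extended by zero to the line -/

/-- The extension by zero of the `i`-th derivative of a weight on `[0,1]`. -/
noncomputable def weightDeriv (w : ℝ → ℝ) (i : ℕ) : ℝ → ℝ :=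
  (Set.Icc (0 : ℝ) 1).indicator (iteratedDerivWithin i w (Set.Icc 0 1))

theorem weightDeriv_zero_of_mem {w : ℝ → ℝ} {x : ℝ} (hx : x ∈ Set.Icc (0 : ℝ) 1) :
    weightDeriv w 0 x = w x := by
  simp [weightDeriv, hx]

section Weight

variable {m : ℕ} {w : ℝ → ℝ}

theorem IsWeight.weightDeriv_eq_zero (hw : IsWeight m w) {i : ℕ} (hi : i ≤ m) {x : ℝ}
    (hx : x ∈ Set.Iic (0 : ℝ) ∪ Set.Ici 1) : weightDeriv w i x = 0 := by
  by_cases h : x ∈ Set.Icc (0 : ℝ) 1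
  · rcases hx with hx | hx
    · obtain rfl : x = 0 := le_antisymm hx h.1
      simpa [weightDeriv] using hw.deriv_zero i hi
    · obtain rfl : x = 1 := le_antisymm h.2 hx
      simpa [weightDeriv] using hw.deriv_one i hi
  · simp [weightDeriv, h]

/-- The derivative within `[0,1]` and the zero derivative within the closed complement agree at the
end points, where `w^(i+1)` vanishes; the two sets cover the line, so they glue to a two-sided
derivative. -/
theorem IsWeight.hasDerivAt (hw : IsWeight m w) {i : ℕ} (hi : i < m) (x : ℝ) :
    HasDerivAt (weightDeriv w i) (weightDeriv w (i + 1) x) x := by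
  have hu : UniqueDiffOn ℝ (Set.Icc (0 : ℝ) 1) := uniqueDiffOn_Icc one_pos
  have h1 : x ∈ Set.Icc (0 : ℝ) 1 →
      HasDerivWithinAt (weightDeriv w i) (weightDeriv w (i + 1) x) (Set.Icc 0 1) x := by
    intro hx
    have hd := (hw.contDiffOn.differentiableOn_iteratedDerivWithin
      (by exact_mod_cast hi) hu x hx).hasDerivWithinAt
    rw [← iteratedDerivWithin_succ] at hd
    have : weightDeriv w (i + 1) x = iteratedDerivWithin (i + 1) w (Set.Icc 0 1) x := by
      simp [weightDeriv, hx]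
    rw [this]
    exact hd.congr_of_mem (fun y hy => by simp only [weightDeriv, Set.indicator_of_mem hy]) hx
  have h2 : x ∈ Set.Iic (0 : ℝ) ∪ Set.Ici 1 →
      HasDerivWithinAt (weightDeriv w i) (weightDeriv w (i + 1) x)
        (Set.Iic (0 : ℝ) ∪ Set.Ici 1) x := by
    intro hx
    rw [hw.weightDeriv_eq_zero hi hx]
    exact (hasDerivWithinAt_const x _ (0 : ℝ)).congr_of_mem
      (fun y hy => hw.weightDeriv_eq_zero hi.le hy) hx
  by_cases hx1 : x ∈ Set.Icc (0 : ℝ) 1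
  · by_cases hx2 : x ∈ Set.Iic (0 : ℝ) ∪ Set.Ici 1
    · have h := (h1 hx1).union (h2 hx2)
      have hun : Set.Icc (0 : ℝ) 1 ∪ (Set.Iic (0 : ℝ) ∪ Set.Ici 1) = Set.univ := by
        ext y
        simp only [Set.mem_union, Set.mem_Icc, Set.mem_Iic, Set.mem_Ici, Set.mem_univ, iff_true]
        grind
      rwa [hun, hasDerivWithinAt_univ] at h
    · simp only [Set.mem_union, Set.mem_Iic, Set.mem_Ici, not_or, not_le] at hx2
      exact (h1 hx1).hasDerivAt (Icc_mem_nhds hx2.1 hx2.2)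
  · have hx2 : x < 0 ∨ 1 < x := by
      simp only [Set.mem_Icc, not_and_or, not_le] at hx1
      exact hx1
    rcases hx2 with hx2 | hx2
    · exact (h2 (Or.inl hx2.le)).hasDerivAt (mem_of_superset (Iic_mem_nhds hx2) (by simp))
    · exact (h2 (Or.inr hx2.le)).hasDerivAt (mem_of_superset (Ici_mem_nhds hx2) (by simp))

theorem IsWeight.continuous_weightDeriv (hw : IsWeight m w) {i : ℕ} (hi : i < m) :
    Continuous (weightDeriv w i) :=
  continuous_iff_continuousAt.2 fun x => (hw.hasDerivAt hi x).continuousAt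

theorem IsWeight.continuous_weightDeriv_top (hw : IsWeight m w) :
    ContinuousOn (weightDeriv w m) (Set.Icc 0 1) :=
  (hw.contDiffOn.continuousOn_iteratedDerivWithin le_rfl (uniqueDiffOn_Icc one_pos)).congr
    fun y hy => by simp only [weightDeriv, Set.indicator_of_mem hy]

theorem IsWeight.exists_bound (hw : IsWeight m w) :
    ∃ K : ℝ, 0 ≤ K ∧ ∀ x, |weightDeriv w m x| ≤ K := by
  obtain ⟨K, hK⟩ := isCompact_Icc.exists_bound_of_continuousOn hw.continuous_weightDeriv_top
  refine ⟨max K 0, le_max_right _ _, fun x => ?_⟩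
  by_cases hx : x ∈ Set.Icc (0 : ℝ) 1
  · exact (hK x hx).trans (le_max_left _ _)
  · simp [weightDeriv, hx]

/-- The normalizing sums `A_N` grow at least linearly. -/
theorem IsWeight.exists_le_sum (hw : IsWeight m w) :
    ∃ c : ℝ, 0 < c ∧ ∀ N : ℕ, 2 ≤ N → c * N ≤ ∑ n ∈ Finset.range N, w ((n : ℝ) / N) := by
  have hsub : Set.Icc (1 / 4 : ℝ) (3 / 4) ⊆ Set.Icc 0 1 := Set.Icc_subset_Icc (by norm_num)
    (by norm_num)
  obtain ⟨x₀, hx₀, hmin⟩ := isCompact_Icc.exists_isMinOn (s := Set.Icc (1 / 4 : ℝ) (3 / 4))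
    ⟨1 / 4, by norm_num⟩ (hw.contDiffOn.continuousOn.mono hsub)
  have hpos : 0 < w x₀ := hw.pos x₀ ⟨by linarith [hx₀.1], by linarith [hx₀.2]⟩
  refine ⟨w x₀ / 8, by positivity, fun N hN => ?_⟩
  have hN0 : (0 : ℝ) < N := by exact_mod_cast (by omega : 0 < N)
  have hw0 : w 0 = 0 := by simpa using hw.deriv_zero 0 (Nat.zero_le _)
  -- The range is `⌈N/4⌉ ≤ n ≤ ⌊3N/4⌋`, where `w(n/N)` is at least the minimum of `w` on `[1/4,
  -- 3/4]`. It contains at least `N/8` integers once `N ≥ 2`, and is empty for `N = 1`.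
  calc w x₀ / 8 * N ≤ ∑ n ∈ Finset.Icc ((N + 3) / 4) (3 * N / 4), w x₀ := by
        rw [Finset.sum_const, Nat.card_Icc, nsmul_eq_mul]
        have : (N : ℝ) ≤ 8 * ((3 * N / 4 + 1 - (N + 3) / 4 : ℕ) : ℝ) := by
          exact_mod_cast (by omega : N ≤ 8 * (3 * N / 4 + 1 - (N + 3) / 4))
        nlinarith
    _ ≤ ∑ n ∈ Finset.Icc ((N + 3) / 4) (3 * N / 4), w ((n : ℝ) / N) := by
        refine Finset.sum_le_sum fun n hn => hmin ?_
        rw [Finset.mem_Icc] at hn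
        have h1 : (N : ℝ) ≤ 4 * n := by exact_mod_cast (by omega : N ≤ 4 * n)
        have h2 : (4 : ℝ) * n ≤ 3 * N := by exact_mod_cast (by omega : 4 * n ≤ 3 * N)
        constructor
        · rw [le_div_iff₀ hN0]; linarith
        · rw [div_le_iff₀ hN0]; linarith
    _ ≤ ∑ n ∈ Finset.range N, w ((n : ℝ) / N) := by
        refine Finset.sum_le_sum_of_subset_of_nonneg ?_ fun n hn _ => ?_
        · intro n hn
          rw [Finset.mem_Icc] at hn
          rw [Finset.mem_range]
          omega
        · rw [Finset.mem_range] at hn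
          rcases Nat.eq_zero_or_pos n with rfl | h
          · simp [hw0]
          · refine (hw.pos _ ⟨by positivity, ?_⟩).le
            rw [div_lt_one hN0]
            exact_mod_cast hn

end Weight

/-! ### Finite differences and summation by parts -/

section Differences

/-- The `m`-th difference with step `h` is at most `h ^ m` times the `m`-th derivative. -/
theorem abs_fwdDiff_iter_le (h : ℝ) (m : ℕ) : ∀ (g : ℕ → ℝ → ℝ) (K : ℝ),
    (∀ i < m, ∀ x, HasDerivAt (g i) (g (i + 1) x) x) → (∀ x, |g m x| ≤ K) →
    ∀ x, |(fwdDiff h)^[m] (g 0) x| ≤ K * |h| ^ m := by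
  induction m with
  | zero => intro g K _ hK x; simpa using hK x
  | succ m ih =>
    intro g K hg hK x
    -- The differenced family is again a chain of derivatives; by the mean value inequality its
    -- `m`-th member is bounded by `K|h|`.
    have := ih (fun i => fwdDiff h (g i)) (K * |h|) (fun i hi x => ?_) (fun x => ?_) x
    · rw [Function.iterate_succ_apply]
      exact this.trans_eq (by ring)
    · exact ((hg i (by omega) (x + h)).comp_add_const x h).sub (hg i (by omega) x)
    · have := Convex.norm_image_sub_le_of_norm_hasDerivWithin_le (s := Set.univ) (x := x)
        (y := x + h) (fun y _ => (hg m (by omega) y).hasDerivWithinAt) (fun y _ => hK y)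
        convex_univ (Set.mem_univ _) (Set.mem_univ _)
      simpa [fwdDiff] using this

/-- Abel summation as a shift of index. Summing over all of `ℤ` with finite support leaves no
boundary terms. -/
theorem tsum_fwdDiff_mul_zpow {a : ℤ → ℂ} (ha : (Function.support a).Finite) {e : ℂ}
    (he : e ≠ 0) :
    ∑' n : ℤ, fwdDiff 1 a n * e ^ n = (e⁻¹ - 1) * ∑' n : ℤ, a n * e ^ n := by
  have hs : Summable fun n : ℤ => a n * e ^ n :=
    summable_of_hasFiniteSupport (ha.subset (Function.support_mul_subset_left _ _))
  have hs' : HasSum (fun n : ℤ => a (n + 1) * e ^ (n + 1)) (∑' n : ℤ, a n * e ^ n) :=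
    (Equiv.hasSum_iff (Equiv.addRight (1 : ℤ)) (f := fun n : ℤ => a n * e ^ n)).2 hs.hasSum
  refine ((((hs'.mul_left e⁻¹).sub hs.hasSum).congr_fun fun n => ?_).tsum_eq).trans (by ring)
  rw [fwdDiff, zpow_add_one₀ he]
  field_simp

theorem fwdDiff_iter_eq_zero {a : ℤ → ℂ} {N : ℤ} (ha : ∀ n, n ≤ 0 ∨ N ≤ n → a n = 0) (m : ℕ) :
    ∀ n : ℤ, n ≤ -m ∨ N ≤ n → (fwdDiff 1)^[m] a n = 0 := by
  induction m with
  | zero => simpa using ha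
  | succ m ih =>
    intro n hn
    push_cast at hn
    rw [Function.iterate_succ_apply', fwdDiff, ih _ (by omega), ih _ (by omega), sub_zero]

theorem finite_support_fwdDiff_iter {a : ℤ → ℂ} {N : ℤ} (ha : ∀ n, n ≤ 0 ∨ N ≤ n → a n = 0)
    (m : ℕ) : (Function.support ((fwdDiff 1)^[m] a)).Finite := by
  refine (Set.finite_Ioo (-(m : ℤ)) N).subset fun n hn => ?_
  by_contra h
  exact hn (fwdDiff_iter_eq_zero ha m n (by simp only [Set.mem_Ioo] at h; omega))

theorem tsum_fwdDiff_iter_mul_zpow {a : ℤ → ℂ} {N : ℤ} (ha : ∀ n, n ≤ 0 ∨ N ≤ n → a n = 0)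
    {e : ℂ} (he : e ≠ 0) (m : ℕ) :
    ∑' n : ℤ, (fwdDiff 1)^[m] a n * e ^ n = (e⁻¹ - 1) ^ m * ∑' n : ℤ, a n * e ^ n := by
  induction m with
  | zero => simp
  | succ m ih =>
    rw [Function.iterate_succ_apply', tsum_fwdDiff_mul_zpow (finite_support_fwdDiff_iter ha m) he,
      ih]
    ring

theorem fwdDiff_iter_sample (g : ℝ → ℝ) (h : ℝ) (m : ℕ) (n : ℤ) :
    (fwdDiff 1)^[m] (fun n : ℤ => (g (n * h) : ℂ)) n = (((fwdDiff h)^[m] g (n * h) : ℝ) : ℂ) := by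
  induction m generalizing n with
  | zero => rfl
  | succ m ih =>
    rw [Function.iterate_succ_apply', Function.iterate_succ_apply', fwdDiff, fwdDiff, ih, ih]
    push_cast
    rw [add_mul, one_mul]

end Differences

/-! ### Decay of weighted exponential sums and integrals -/

/-- With `y = x - round x`, the right side is `2|sin πy|`, and `|sin t| ≥ 2|t|/π` for `|t| ≤ π/2`.
This turns the distance to the integers into a lower bound for the divisor of Abel summation. -/
theorem four_mul_abs_sub_round_le (x : ℝ) :
    4 * |x - round x| ≤ ‖(Complex.exp (2 * Real.pi * Complex.I * x))⁻¹ - 1‖ := by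
  set y : ℝ := x - round x with hy
  have h1 : (Complex.exp (2 * Real.pi * Complex.I * x))⁻¹
      = Complex.exp (Complex.I * ((-(2 * Real.pi * y) : ℝ) : ℂ)) := by
    rw [← Complex.exp_neg, Complex.exp_eq_exp_iff_exists_int]
    refine ⟨-round x, ?_⟩
    push_cast [hy]
    ring
  rw [h1, Complex.norm_exp_I_mul_ofReal_sub_one, norm_mul, Real.norm_eq_abs, Real.norm_eq_abs]
  have h2 : -(2 * Real.pi * y) / 2 = -(Real.pi * y) := by ring
  rw [h2, Real.sin_neg, abs_neg, abs_two]
  have h3 := Real.mul_abs_le_abs_sin (x := Real.pi * y) (by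
    rw [abs_mul, abs_of_pos Real.pi_pos]
    nlinarith [abs_sub_round x, Real.pi_pos])
  rw [abs_mul, abs_of_pos Real.pi_pos] at h3
  have h4 : 2 / Real.pi * (Real.pi * |y|) = 2 * |y| := by
    field_simp
  linarith

/-- Summation by parts: the exponential sums with weight `w` decay like `N ^ (1 - m)`. -/
theorem IsWeight.norm_sum_le {m : ℕ} {w : ℝ → ℝ} (hw : IsWeight m w) {K : ℝ}
    (hK : ∀ x, |weightDeriv w m x| ≤ K) {N : ℕ} (hN : 1 ≤ N) {x δ : ℝ} (hδ : 0 < δ)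
    (hx : ∀ n : ℤ, δ ≤ |x - n|) :
    ‖∑ n ∈ Finset.range N, (w ((n : ℝ) / N) : ℂ) * Complex.exp (2 * Real.pi * Complex.I * x) ^ n‖
      ≤ K * (m + 1) * N / ((N : ℝ) ^ m * δ ^ m) := by
  set e := Complex.exp (2 * Real.pi * Complex.I * x) with he
  have he0 : e ≠ 0 := Complex.exp_ne_zero _
  have hen : ‖e‖ = 1 := by
    rw [he, show (2 * Real.pi * Complex.I * x : ℂ) = ((2 * Real.pi * x : ℝ) : ℂ) * Complex.I by
      push_cast; ring, Complex.norm_exp_ofReal_mul_I]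
  have hN0 : (0 : ℝ) < N := by exact_mod_cast hN
  have hK0 : 0 ≤ K := (abs_nonneg _).trans (hK 0)
  set a : ℤ → ℂ := fun n => (weightDeriv w 0 (n * (N : ℝ)⁻¹) : ℂ) with ha
  have ha0 : ∀ n : ℤ, n ≤ 0 ∨ (N : ℤ) ≤ n → a n = 0 := by
    intro n hn
    rw [ha]
    simp only [Complex.ofReal_eq_zero]
    refine hw.weightDeriv_eq_zero (Nat.zero_le _) ?_
    rcases hn with hn | hn
    · left
      exact mul_nonpos_of_nonpos_of_nonneg (by exact_mod_cast hn) (inv_nonneg.2 hN0.le)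
    · right
      rw [Set.mem_Ici, ← div_eq_mul_inv, one_le_div hN0]
      exact_mod_cast hn
  have hsum : ∑ n ∈ Finset.range N, (w ((n : ℝ) / N) : ℂ) * e ^ n = ∑' n : ℤ, a n * e ^ n := by
    rw [tsum_eq_sum (s := (Finset.range N).map Nat.castEmbedding)]
    · rw [Finset.sum_map]
      refine Finset.sum_congr rfl fun n hn => ?_
      rw [Finset.mem_range] at hn
      have : (n : ℝ) / N ∈ Set.Icc (0 : ℝ) 1 :=
        ⟨by positivity, by rw [div_le_one hN0]; exact_mod_cast hn.le⟩
      simp only [ha, Nat.castEmbedding_apply, Int.cast_natCast, zpow_natCast]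
      rw [← div_eq_mul_inv, weightDeriv_zero_of_mem this]
    · intro n hn
      rw [ha0 n, zero_mul]
      by_contra h
      push Not at h
      refine hn (Finset.mem_map.2 ⟨n.toNat, Finset.mem_range.2 (by omega), ?_⟩)
      simp only [Nat.castEmbedding_apply]
      omega
  have hbd : ∀ n : ℤ, ‖(fwdDiff 1)^[m] a n * e ^ n‖ ≤ K * ((N : ℝ)⁻¹) ^ m := by
    intro n
    rw [norm_mul, norm_zpow, hen, one_zpow, mul_one, ha, fwdDiff_iter_sample, Complex.norm_real]
    refine (abs_fwdDiff_iter_le _ m (weightDeriv w) K (fun i hi => hw.hasDerivAt hi) hK _).trans_eq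
      ?_
    rw [abs_of_pos (by positivity)]
  -- Each difference extends the support one step to the left, so at most `N + m` terms contribute.
  have htot : ‖∑' n : ℤ, (fwdDiff 1)^[m] a n * e ^ n‖ ≤ (N + m) * (K * ((N : ℝ)⁻¹) ^ m) := by
    rw [tsum_eq_sum (s := Finset.Ioc (-(m : ℤ)) N)]
    · refine (norm_sum_le_of_le _ fun n _ => hbd n).trans_eq ?_
      rw [Finset.sum_const, nsmul_eq_mul, Int.card_Ioc]
      congr 1
      rw [show ((N : ℤ) - -(m : ℤ)).toNat = N + m by omega]
      push_cast
      rfl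
    · intro n hn
      rw [fwdDiff_iter_eq_zero ha0 m n, zero_mul]
      simp only [Finset.mem_Ioc] at hn
      omega
  rw [tsum_fwdDiff_iter_mul_zpow ha0 he0, norm_mul, norm_pow, ← hsum] at htot
  have hδe : δ ≤ ‖e⁻¹ - 1‖ := by
    have h1 := four_mul_abs_sub_round_le x
    have h2 := hx (round x)
    rw [← he] at h1
    linarith [abs_nonneg (x - round x)]
  have hpow : δ ^ m ≤ ‖e⁻¹ - 1‖ ^ m := pow_le_pow_left₀ hδ.le hδe m
  rw [le_div_iff₀ (by positivity)]
  set S := ‖∑ n ∈ Finset.range N, (w ((n : ℝ) / N) : ℂ) * e ^ n‖ with hS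
  calc S * ((N : ℝ) ^ m * δ ^ m) ≤ (N : ℝ) ^ m * (‖e⁻¹ - 1‖ ^ m * S) := by
        have := mul_le_mul_of_nonneg_left hpow (norm_nonneg
          (∑ n ∈ Finset.range N, (w ((n : ℝ) / N) : ℂ) * e ^ n))
        have := mul_le_mul_of_nonneg_left this (by positivity : 0 ≤ (N : ℝ) ^ m)
        rw [← hS] at this
        linarith
    _ ≤ (N : ℝ) ^ m * ((N + m) * (K * ((N : ℝ)⁻¹) ^ m)) := by gcongr
    _ = K * (N + m) := by
        rw [inv_pow]; field_simp
    _ ≤ K * (m + 1) * N := by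
        have h1 : (1 : ℝ) ≤ N := by exact_mod_cast hN
        have : (m : ℝ) ≤ m * N := le_mul_of_one_le_right (by positivity) h1
        nlinarith

/-- Integration by parts: the oscillatory integrals with weight `w` decay like `|y| ^ (-m)`. -/
theorem IsWeight.norm_integral_le {m : ℕ} {w : ℝ → ℝ} (hw : IsWeight m w) {K : ℝ}
    (hK : ∀ x, |weightDeriv w m x| ≤ K) {y : ℝ} (hy : y ≠ 0) :
    ‖∫ s in (0 : ℝ)..1, (w s : ℂ) * Complex.exp (2 * Real.pi * Complex.I * y * s)‖
      ≤ K / |y| ^ m := by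
  set c : ℂ := 2 * Real.pi * Complex.I * y with hc
  have hc0 : c ≠ 0 := by
    have := Real.pi_ne_zero
    simp [hc, hy]
  have hcn : |y| ≤ ‖c‖ := by
    rw [hc]
    simp only [norm_mul, Complex.norm_I, Complex.norm_real, Complex.norm_ofNat, mul_one,
      Real.norm_eq_abs, abs_of_pos Real.pi_pos]
    nlinarith [Real.pi_gt_three, abs_nonneg y]
  have hint : ∀ i ≤ m, IntervalIntegrable (fun s => (weightDeriv w i s : ℂ)) volume 0 1 := by
    intro i hi
    refine ContinuousOn.intervalIntegrable ?_
    rw [Set.uIcc_of_le zero_le_one]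
    rcases hi.lt_or_eq with h | rfl
    · exact (Complex.continuous_ofReal.comp (hw.continuous_weightDeriv h)).continuousOn
    · exact Complex.continuous_ofReal.comp_continuousOn hw.continuous_weightDeriv_top
  -- The boundary terms vanish because the derivatives of `w` of order below `m` are zero at `0` and
  -- `1`.
  have hparts : ∀ i ≤ m, ∫ s in (0 : ℝ)..1, (weightDeriv w 0 s : ℂ) * Complex.exp (c * s)
      = (-c⁻¹) ^ i * ∫ s in (0 : ℝ)..1, (weightDeriv w i s : ℂ) * Complex.exp (c * s) := by
    intro i
    induction i with
    | zero => simp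
    | succ i ih =>
      intro hi
      rw [ih (by omega)]
      have hexp : ∀ s : ℝ, HasDerivAt (fun s : ℝ => c⁻¹ * Complex.exp (c * s))
          (Complex.exp (c * s)) s := by
        intro s
        have h1 : HasDerivAt (fun z : ℂ => c⁻¹ * Complex.exp (c * z)) (Complex.exp (c * s)) s := by
          refine ((hasDerivAt_const_mul c).cexp.const_mul c⁻¹).congr_deriv ?_
          field_simp
        exact h1.comp_ofReal
      have := intervalIntegral.integral_mul_deriv_eq_deriv_mul (a := 0) (b := 1)
        (u := fun s => (weightDeriv w i s : ℂ)) (u' := fun s => (weightDeriv w (i + 1) s : ℂ))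
        (v := fun s : ℝ => c⁻¹ * Complex.exp (c * s)) (v' := fun s : ℝ => Complex.exp (c * s))
        (fun s _ => (hw.hasDerivAt (by omega) s).ofReal_comp) (fun s _ => hexp s)
        (hint _ hi) (Continuous.intervalIntegrable (by fun_prop) _ _)
      rw [this, hw.weightDeriv_eq_zero (by omega) (x := 1) (by simp),
        hw.weightDeriv_eq_zero (by omega) (x := 0) (by simp)]
      have h2 : ∀ s : ℝ, (weightDeriv w (i + 1) s : ℂ) * (c⁻¹ * Complex.exp (c * s))
          = c⁻¹ * ((weightDeriv w (i + 1) s : ℂ) * Complex.exp (c * s)) := fun s => by ring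
      simp only [h2, intervalIntegral.integral_const_mul]
      push_cast
      ring
  have hcongr : ∫ s in (0 : ℝ)..1, (w s : ℂ) * Complex.exp (c * s)
      = ∫ s in (0 : ℝ)..1, (weightDeriv w 0 s : ℂ) * Complex.exp (c * s) := by
    refine intervalIntegral.integral_congr fun s hs => ?_
    rw [Set.uIcc_of_le zero_le_one] at hs
    simp only [weightDeriv_zero_of_mem hs]
  rw [hcongr, hparts m le_rfl, norm_mul, norm_pow, norm_neg, norm_inv]
  have hI : ‖∫ s in (0 : ℝ)..1, (weightDeriv w m s : ℂ) * Complex.exp (c * s)‖ ≤ K := by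
    have := intervalIntegral.norm_integral_le_of_norm_le_const (a := (0 : ℝ)) (b := 1) (C := K)
      (f := fun s : ℝ => (weightDeriv w m s : ℂ) * Complex.exp (c * s)) (fun s _ => ?_)
    · simpa using this
    · rw [norm_mul, Complex.norm_real, Complex.norm_exp]
      have : (c * s).re = 0 := by simp [hc]
      rw [this, Real.exp_zero, mul_one]
      exact hK s
  have hK0 : 0 ≤ K := (abs_nonneg _).trans (hK 0)
  have hy0 : 0 < |y| := abs_pos.2 hy
  rw [div_eq_mul_inv, mul_comm K, ← inv_pow]
  gcongr

/-! ### Summability over the infinite-dimensional lattice -/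

/-- The sum of a product over all finitely supported families converges as soon as the sum of
all nontrivial factors does. -/
theorem summable_finsupp_prod {ι : Type*} {g : ι → ℤ → ℝ} (hg : ∀ j n, 0 ≤ g j n)
    (hs : Summable fun p : ι × ℤ => if p.2 = 0 then 0 else g p.1 p.2) :
    Summable fun k : ι →₀ ℤ => k.prod g := by
  classical
  set u : ι × ℤ → ℝ := fun p => if p.2 = 0 then 0 else g p.1 p.2 with hu
  have hu0 : ∀ p, 0 ≤ u p := fun p => by
    simp only [hu]; split_ifs
    · exact le_rfl
    · exact hg _ _
  refine summable_of_sum_le (c := Real.exp (∑' p, u p))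
    (fun k => Finset.prod_nonneg fun j _ => hg j _) fun S => ?_
  -- Any finite `S` lies in the box of families supported in `J` with values in `A ∋ 0`, over which
  -- the sum of products factorizes. Setting `h j 0 = 1` extends each product from the support to
  -- `J`; then `1 + x ≤ e^x` bounds the factors.
  set J : Finset ι := S.biUnion Finsupp.support with hJ
  set A : Finset ℤ := insert 0 (S.biUnion fun k => k.support.image k) with hA
  set h : ι → ℤ → ℝ := fun j n => if n = 0 then 1 else g j n with hh
  have hh0 : ∀ j n, 0 ≤ h j n := fun j n => by
    simp only [hh]; split_ifs
    · exact zero_le_one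
    · exact hg _ _
  have hprod : ∀ k : ι →₀ ℤ, k.prod g = k.prod h := fun k =>
    Finset.prod_congr rfl fun j hj => by simp [hh, Finsupp.mem_support_iff.1 hj]
  have hsub : S ⊆ J.finsupp fun _ => A := by
    intro k hk
    rw [Finset.mem_finsupp_iff]
    refine ⟨Finset.subset_biUnion_of_mem Finsupp.support hk, fun j _ => ?_⟩
    by_cases hkj : k j = 0
    · simp [hA, hkj]
    · refine Finset.mem_insert_of_mem (Finset.mem_biUnion.2 ⟨k, hk, ?_⟩)
      exact Finset.mem_image_of_mem _ (Finsupp.mem_support_iff.2 hkj)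
  calc ∑ k ∈ S, k.prod g ≤ ∑ k ∈ J.finsupp fun _ => A, k.prod g :=
        Finset.sum_le_sum_of_subset_of_nonneg hsub fun k _ _ =>
          Finset.prod_nonneg fun j _ => hg j _
    _ = ∑ p ∈ J.pi fun _ => A, ∏ j ∈ J.attach, h j.1 (p j.1 j.2) := by
        rw [Finset.finsupp, Finset.sum_map]
        refine Finset.sum_congr rfl fun p _ => ?_
        rw [hprod, Function.Embedding.coeFn_mk,
          Finsupp.prod_of_support_subset _ (Finsupp.support_indicator_subset J p) _
            (fun j _ => by simp [hh]), ← Finset.prod_attach]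
        exact Finset.prod_congr rfl fun j _ => by rw [Finsupp.indicator_of_mem j.2]
    _ = ∏ j ∈ J, ∑ n ∈ A, h j n := (Finset.prod_sum J (fun _ => A) h).symm
    _ ≤ ∏ j ∈ J, Real.exp (∑ n ∈ A, u (j, n)) := by
        refine Finset.prod_le_prod (fun j _ => Finset.sum_nonneg fun n _ => hh0 j n) fun j _ => ?_
        have h1 : ∑ n ∈ A, h j n = 1 + ∑ n ∈ A, u (j, n) := by
          have : ∀ n, h j n = (if n = 0 then 1 else 0) + u (j, n) := fun n => by
            simp only [hh, hu]; split_ifs <;> simp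
          simp only [this, Finset.sum_add_distrib]
          rw [Finset.sum_ite_eq', if_pos (by simp [hA])]
        rw [h1, add_comm]
        exact Real.add_one_le_exp _
    _ = Real.exp (∑ p ∈ J ×ˢ A, u p) := by rw [← Real.exp_sum, Finset.sum_product]
    _ ≤ Real.exp (∑' p, u p) := Real.exp_le_exp.2 (hs.sum_le_tsum _ fun p _ => hu0 p)

theorem one_le_bracket (j : ℕ) : 1 ≤ bracket j := le_max_left _ _

theorem summable_bracket_inv_sq : Summable fun j : ℕ => (bracket j ^ 2)⁻¹ := by
  have h := (Real.summable_nat_pow_inv (p := 2)).2 one_lt_two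
  refine (summable_nat_add_iff 1).1 (((summable_nat_add_iff 1).2 h).congr fun j => ?_)
  rw [bracket, max_eq_right (by push_cast; linarith [(Nat.cast_nonneg j : (0 : ℝ) ≤ j)])]

theorem summable_int_inv_sq : Summable fun n : ℤ => ((n : ℝ) ^ 2)⁻¹ := by
  simpa using Real.summable_one_div_int_pow.2 one_lt_two

theorem exists_rpow_mul_exp_neg_le {a : ℝ} (ha : 0 < a) (p : ℝ) :
    ∃ C : ℝ, 0 ≤ C ∧ ∀ u : ℝ, 1 ≤ u → u ^ p * Real.exp (-a * u) ≤ C := by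
  have ht := tendsto_rpow_mul_exp_neg_mul_atTop_nhds_zero p a ha
  obtain ⟨R, hR⟩ := eventually_atTop.1 (ht.eventually (gt_mem_nhds one_pos))
  obtain ⟨C, hC⟩ := (isCompact_Icc (a := (1 : ℝ)) (b := R)).exists_bound_of_continuousOn
    (f := fun u : ℝ => u ^ p * Real.exp (-a * u)) (ContinuousOn.mul
      (fun u hu => (Real.continuousAt_rpow_const u p
        (Or.inl (by linarith [hu.1]))).continuousWithinAt)
      (by fun_prop))
  refine ⟨max C 1, le_max_of_le_right zero_le_one, fun u hu => ?_⟩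
  rcases le_total u R with h | h
  · exact (le_abs_self _).trans ((hC u ⟨hu, h⟩).trans (le_max_left _ _))
  · exact (hR u h).le.trans (le_max_right _ _)

/-- Exponential decay in `|k|_η` beats every power of the small divisors, with `η ≥ 2`. -/
theorem summable_exp_neg_etaNorm_mul_pow {η : ℕ} (hη : 2 ≤ η) {μ : ℝ} (hμ : 0 ≤ μ) (m : ℕ)
    {a : ℝ} (ha : 0 < a) :
    Summable fun k : ℕ →₀ ℤ => Real.exp (-a * etaNorm η k) * bourgainDenominator μ k ^ m := by
  set g : ℕ → ℤ → ℝ := fun j n => Real.exp (-a * (bracket j ^ η * |(n : ℝ)|)) *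
    (1 + |(n : ℝ)| ^ μ * bracket j ^ μ) ^ m with hg
  have hb0 : ∀ j, 0 < bracket j := fun j => one_pos.trans_le (one_le_bracket j)
  have hg0 : ∀ j n, 0 ≤ g j n := fun j n => by have := hb0 j; positivity
  have heq : ∀ k : ℕ →₀ ℤ,
      Real.exp (-a * etaNorm η k) * bourgainDenominator μ k ^ m = k.prod g := by
    intro k
    simp only [hg, Finsupp.prod, etaNorm, Finsupp.sum, bourgainDenominator]
    rw [Finset.prod_mul_distrib, Finset.prod_pow, ← Real.exp_sum, Finset.mul_sum]
  simp only [heq]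
  refine summable_finsupp_prod hg0 ?_
  -- With `u = ⟨j⟩^η |n|`, the power `u^(μm)` absorbs the denominator, and the extra `u^2` leaves
  -- `u^(-2) ≤ ⟨j⟩^(-2) n^(-2)`, summable over `j` and `n ≠ 0`.
  obtain ⟨C, hC0, hC⟩ := exists_rpow_mul_exp_neg_le ha (μ * m + 2)
  refine Summable.of_nonneg_of_le (fun p => ?_) (fun p => ?_)
    ((summable_bracket_inv_sq.mul_of_nonneg summable_int_inv_sq
      (fun j => by positivity) (fun n => by positivity)).mul_left (2 ^ m * C))
  · split_ifs
    · exact le_rfl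
    · exact hg0 _ _
  · obtain ⟨j, n⟩ := p
    simp only
    split_ifs with hn
    · have := hb0 j; positivity
    have hn1 : 1 ≤ |(n : ℝ)| := by exact_mod_cast Int.one_le_abs hn
    have hb1 := one_le_bracket j
    set b := bracket j with hb
    have hb : 0 < b := hb0 j
    set ν := |(n : ℝ)| with hν
    have hu1 : 1 ≤ b * ν := one_le_mul_of_one_le_of_one_le hb1 hn1
    have hbu : b * ν ≤ b ^ η * ν := by
      gcongr
      exact le_self_pow₀ hb1 (by omega)
    set u := b ^ η * ν with hu
    have hu0 : 0 < u := by linarith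
    have h1 : 1 + ν ^ μ * b ^ μ ≤ 2 * u ^ μ := by
      rw [← Real.mul_rpow (by positivity) (by positivity), mul_comm ν]
      have h2 := Real.one_le_rpow (hu1.trans hbu) hμ
      have h3 := Real.rpow_le_rpow (by positivity) hbu hμ
      linarith
    have h4 : u ^ (μ * m + 2) = (u ^ μ) ^ m * u ^ 2 := by
      rw [Real.rpow_add hu0, Real.rpow_mul hu0.le, Real.rpow_natCast, Real.rpow_ofNat]
    have h5 : b ^ 2 * (n : ℝ) ^ 2 ≤ u ^ 2 := by
      rw [← sq_abs (n : ℝ), ← mul_pow]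
      exact pow_le_pow_left₀ (by positivity) hbu 2
    have hn2 : 0 < (n : ℝ) ^ 2 := by
      rw [← sq_abs]; positivity
    calc g j n ≤ Real.exp (-a * u) * (2 * u ^ μ) ^ m := by
          simp only [hg]
          gcongr
      _ = 2 ^ m * (u ^ (μ * m + 2) * Real.exp (-a * u)) * (u ^ 2)⁻¹ := by
          rw [h4, mul_pow]
          field_simp
      _ ≤ 2 ^ m * C * (b ^ 2 * (n : ℝ) ^ 2)⁻¹ := by
          gcongr
          exact hC u (hu1.trans hbu)
      _ = 2 ^ m * C * ((b ^ 2)⁻¹ * ((n : ℝ) ^ 2)⁻¹) := by rw [mul_inv]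

theorem one_le_bourgainDenominator (μ : ℝ) (k : ℕ →₀ ℤ) : 1 ≤ bourgainDenominator μ k := by
  refine Finset.one_le_prod fun j _ => ?_
  have := one_le_bracket j
  have : 0 ≤ |(k j : ℝ)| ^ μ * bracket j ^ μ := by positivity
  exact le_add_of_nonneg_right this

/-! ### Haar measure on the torus and real representatives -/

instance : IsProbabilityMeasure torusMeasure := by
  unfold torusMeasure; infer_instance

theorem measurePreserving_add_torusMeasure (c : Torus) :
    MeasurePreserving (fun θ => θ + c) torusMeasure torusMeasure := by
  refine ⟨by fun_prop, ?_⟩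
  have h := Measure.infinitePi_map_pi
    (μ := fun _ : ℕ => (AddCircle.haarAddCircle : Measure UnitAddCircle))
    (f := fun j t => t + c j) (fun j => by fun_prop)
  have h2 : ∀ j, (AddCircle.haarAddCircle : Measure UnitAddCircle).map (fun t => t + c j)
      = AddCircle.haarAddCircle := fun j => (measurePreserving_add_right _ (c j)).map_eq
  simp only [h2] at h
  exact h

/-- Openness is what passes to infinite products. It allows continuity on the torus to be tested on
`ℝ^ℕ`. -/
theorem isOpenQuotientMap_toTorus : IsOpenQuotientMap toTorus :=
  IsOpenQuotientMap.piMap (f := fun _ : ℕ => ((↑) : ℝ → UnitAddCircle)) fun _ =>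
    QuotientAddGroup.isOpenQuotientMap_mk

theorem toTorus_add (x y : ℕ → ℝ) : toTorus (x + y) = toTorus x + toTorus y := rfl

/-- The representative in `[0,1)^ℕ` of a point of the torus. -/
noncomputable def liftReal (θ : Torus) : ℕ → ℝ := fun j => (AddCircle.equivIco (1 : ℝ) 0 (θ j) : ℝ)

theorem toTorus_liftReal (θ : Torus) : toTorus (liftReal θ) = θ :=
  funext fun _ => AddCircle.coe_equivIco

theorem liftReal_mem (θ : Torus) (j : ℕ) : liftReal θ j ∈ Set.Icc (0 : ℝ) 1 := by
  have := (AddCircle.equivIco (1 : ℝ) 0 (θ j)).2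
  exact ⟨this.1, this.2.le.trans_eq (zero_add 1)⟩

theorem exists_int_of_toTorus_eq {x y : ℕ → ℝ} (h : toTorus x = toTorus y) :
    ∃ n : ℕ → ℤ, ∀ j, x j = y j + n j := by
  have : ∀ j, ∃ n : ℤ, x j = y j + n := fun j => by
    have hj : ((x j - y j : ℝ) : UnitAddCircle) = 0 := by
      rw [AddCircle.coe_sub, sub_eq_zero]; exact congrFun h j
    obtain ⟨n, hn⟩ := (AddCircle.coe_eq_zero_iff (1 : ℝ)).1 hj
    refine ⟨n, ?_⟩
    rw [zsmul_eq_mul, mul_one] at hn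
    linarith
  choose n hn using this
  exact ⟨n, hn⟩

/-- The point `x + i y` of `ℂ^ℕ`. -/
noncomputable def complexPoint (x y : ℕ → ℝ) : ℕ → ℂ := fun j => (x j : ℂ) + (y j : ℂ) * Complex.I

@[simp] theorem complexPoint_im (x y : ℕ → ℝ) (j : ℕ) : (complexPoint x y j).im = y j := by
  simp [complexPoint]

@[simp] theorem complexPoint_re (x y : ℕ → ℝ) (j : ℕ) : (complexPoint x y j).re = x j := by
  simp [complexPoint]

theorem complexPoint_mem_tube {η : ℕ} {σ : ℝ} {y : ℕ → ℝ} (hy : ∀ j, |y j| < σ * bracket j ^ η)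
    (x : ℕ → ℝ) : complexPoint x y ∈ tube η σ := fun j => by simpa using hy j

theorem update_mem_tube {η : ℕ} {σ : ℝ} {z : ℕ → ℂ} (hz : z ∈ tube η σ) {a : ℕ} {s : ℂ}
    (hs : |s.im| < σ * bracket a ^ η) : Function.update z a s ∈ tube η σ := by
  intro j
  rcases eq_or_ne j a with rfl | h
  · simpa using hs
  · simpa [h] using hz j

section Averages

variable {E : Type*} [NormedAddCommGroup E]

variable [NormedSpace ℝ E]

theorem integral_add_torusMeasure {h : Torus → E} (hh : Continuous h) (c : Torus) :
    ∫ θ, h (θ + c) ∂torusMeasure = ∫ θ, h θ ∂torusMeasure := by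
  have hp := measurePreserving_add_torusMeasure c
  have := integral_map (μ := torusMeasure) hp.measurable.aemeasurable (f := h)
    hh.aestronglyMeasurable
  rw [hp.map_eq] at this
  exact this.symm

/-- Integration over the torus after averaging in one coordinate. -/
theorem integral_eq_integral_average [CompleteSpace E] {h : Torus → E} (hh : Continuous h) (a : ℕ) :
    ∫ θ, h θ ∂torusMeasure
      = ∫ θ, (∫ t in (0 : ℝ)..1, h (θ + toTorus (Pi.single a t))) ∂torusMeasure := by
  have hc : Continuous (Function.uncurry fun (t : ℝ) (θ : Torus) =>
      h (θ + toTorus (Pi.single a t))) := by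
    refine hh.comp (continuous_snd.add (isOpenQuotientMap_toTorus.continuous.comp ?_))
    exact (continuous_single a).comp continuous_fst
  obtain ⟨C, hC⟩ := isCompact_univ.exists_bound_of_continuousOn hh.continuousOn
  -- After Fubini the integral over the torus is independent of `t`, by translation invariance.
  rw [← intervalIntegral_integral_swap]
  · simp [integral_add_torusMeasure hh]
  · rw [Set.uIoc_of_le zero_le_one]
    exact Integrable.of_bound hc.aestronglyMeasurable C (ae_of_all _ fun p => hC _ trivial)

end Averages

/-! ### Holomorphic extension, contour shift and decay of Fourier coefficients -/

section Extension

variable {E : Type*} [NormedAddCommGroup E] [NormedSpace ℂ E]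

/-- `F` is separately holomorphic on the tube. -/
def IsSeparatelyHolomorphic (η : ℕ) (σ : ℝ) (F : (ℕ → ℂ) → E) : Prop :=
  ∀ z ∈ tube η σ, ∀ j : ℕ, DifferentiableAt ℂ (fun s : ℂ => F (Function.update z j s)) (z j)

/-- `F` is an analytic extension of the function `f` on the torus to the tube. -/
structure IsAnalyticExtension (η : ℕ) (σ : ℝ) (F : (ℕ → ℂ) → E) (f : Torus → E) : Prop where
  continuousOn : ContinuousOn F (tube η σ)
  separatelyHolomorphic : IsSeparatelyHolomorphic η σ F
  eq_of_real : ∀ x : ℕ → ℝ, F (fun j => (x j : ℂ)) = f (toTorus x)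

variable {η : ℕ} {σ : ℝ} {F : (ℕ → ℂ) → E} {f : Torus → E}

theorem isOpen_strip (r : ℝ) : IsOpen {s : ℂ | |s.im| < r} :=
  isOpen_lt (by fun_prop) continuous_const

theorem convex_strip (r : ℝ) : Convex ℝ {s : ℂ | |s.im| < r} := by
  have : {s : ℂ | |s.im| < r} = Complex.imLm ⁻¹' Set.Ioo (-r) r := by
    ext s; simp [abs_lt]
  rw [this]
  exact (convex_Ioo _ _).linear_preimage _

theorem IsSeparatelyHolomorphic.differentiableOn_slice (hF : IsSeparatelyHolomorphic η σ F)
    {z : ℕ → ℂ} (hz : z ∈ tube η σ) (a : ℕ) :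
    DifferentiableOn ℂ (fun s => F (Function.update z a s)) {s | |s.im| < σ * bracket a ^ η} := by
  intro s hs
  have := hF _ (update_mem_tube hz hs) a
  simp only [Function.update_idem, Function.update_self] at this
  exact this.differentiableWithinAt

/-- Identity theorem: a separately holomorphic function that vanishes at the real points vanishes
at all points with finitely many nonreal coordinates. -/
theorem IsSeparatelyHolomorphic.eq_zero [CompleteSpace E] (hF : IsSeparatelyHolomorphic η σ F)
    (h0 : ∀ x : ℕ → ℝ, F (fun j => (x j : ℂ)) = 0) (S : Finset ℕ) :
    ∀ z ∈ tube η σ, (∀ j ∉ S, (z j).im = 0) → F z = 0 := by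
  induction S using Finset.induction_on with
  | empty =>
    intro z _ hz
    rw [← h0 fun j => (z j).re]
    congr 1
    ext j
    exact Complex.ext (by simp) (by simp [hz j])
  | insert a S _ ih =>
    intro z hz hzS
    have han := (hF.differentiableOn_slice hz a).analyticOnNhd (isOpen_strip _)
    have hr : 0 < σ * bracket a ^ η := (abs_nonneg _).trans_lt (hz a)
    have htend : Tendsto (fun t : ℝ => (t : ℂ)) (𝓝[≠] 0) (𝓝[≠] 0) := by
      refine tendsto_nhdsWithin_of_tendsto_nhds_of_eventually_within _ ?_ ?_
      · exact (Complex.continuous_ofReal.tendsto' 0 0 (by simp)).mono_left nhdsWithin_le_nhds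
      · filter_upwards [self_mem_nhdsWithin] with t ht
        simpa using ht
    -- Making the coordinate `a` real leaves nonreal coordinates only in `S`, so the slice vanishes
    -- on the real axis, which accumulates at `0`; the strip is connected.
    have hfreq : ∃ᶠ s : ℂ in 𝓝[≠] 0, F (Function.update z a s) = 0 := by
      refine htend.frequently (Eventually.frequently (Eventually.of_forall fun t => ?_))
      refine ih _ (update_mem_tube hz (by simpa using hr)) fun j hj => ?_
      rcases eq_or_ne j a with rfl | hja
      · simp
      · simpa [hja] using hzS j (by simp [hja, hj])
    have := han.eqOn_zero_of_preconnected_of_frequently_eq_zero (convex_strip _).isPreconnected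
      (by simpa using hr) hfreq (hz a)
    simpa using this

/-- Periodicity of `F` is known only at real points. The difference `F(z + n) - F(z)` is separately
holomorphic and vanishes there, so the identity theorem applies. -/
theorem IsAnalyticExtension.add_int [CompleteSpace E] (hF : IsAnalyticExtension η σ F f)
    {z : ℕ → ℂ} (hz : z ∈ tube η σ) (S : Finset ℕ) (hS : ∀ j ∉ S, (z j).im = 0) (n : ℕ → ℤ) :
    F (fun j => z j + n j) = F z := by
  have hadd : ∀ z ∈ tube η σ, (fun j => z j + n j) ∈ tube η σ := fun z hz j => by
    simpa using hz j
  have hG : IsSeparatelyHolomorphic η σ fun z => F (fun j => z j + n j) - F z := by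
    intro z hz a
    refine DifferentiableAt.sub ?_ (hF.separatelyHolomorphic z hz a)
    have h1 := hF.separatelyHolomorphic _ (hadd z hz) a
    have h2 : (fun s : ℂ => F fun j => Function.update z a s j + n j)
        = fun s : ℂ => F (Function.update (fun j => z j + n j) a (s + n a)) := by
      ext s
      congr 1
      ext j
      rcases eq_or_ne j a with rfl | h
      · simp
      · simp [h]
    rw [h2]
    exact DifferentiableAt.comp (z a)
      (g := fun s : ℂ => F (Function.update (fun j => z j + n j) a s)) h1 (by fun_prop)
  refine sub_eq_zero.1 (hG.eq_zero (fun x => ?_) S z hz hS)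
  have h1 := hF.eq_of_real fun j => x j + n j
  have h2 : toTorus (fun j => x j + n j) = toTorus x := by
    ext j
    have : ((n j : ℝ) : UnitAddCircle) = 0 :=
      (AddCircle.coe_eq_zero_iff (1 : ℝ)).2 ⟨n j, by simp⟩
    simp only [toTorus, AddCircle.coe_add, this, add_zero]
  rw [h2, ← hF.eq_of_real x] at h1
  push_cast at h1
  rw [h1, sub_self]

/-- The function `x ↦ F (x + i y)` on the torus. -/
noncomputable def imShift (F : (ℕ → ℂ) → E) (y : ℕ → ℝ) (θ : Torus) : E :=
  F (complexPoint (liftReal θ) y)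

/-- The lift `liftReal` is discontinuous; periodicity makes the choice of representative irrelevant,
and this gives continuity of `imShift F y`. -/
theorem IsAnalyticExtension.imShift_toTorus [CompleteSpace E] (hF : IsAnalyticExtension η σ F f)
    {y : ℕ → ℝ} (hy : ∀ j, |y j| < σ * bracket j ^ η) {S : Finset ℕ} (hS : ∀ j ∉ S, y j = 0)
    (x : ℕ → ℝ) : imShift F y (toTorus x) = F (complexPoint x y) := by
  obtain ⟨n, hn⟩ := exists_int_of_toTorus_eq (toTorus_liftReal (toTorus x))
  rw [imShift, ← hF.add_int (complexPoint_mem_tube hy x) S (by simpa using hS) n]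
  congr 1
  ext j
  simp only [complexPoint, hn]
  push_cast
  ring

theorem IsAnalyticExtension.continuous_imShift [CompleteSpace E]
    (hF : IsAnalyticExtension η σ F f)
    {y : ℕ → ℝ} (hy : ∀ j, |y j| < σ * bracket j ^ η) {S : Finset ℕ} (hS : ∀ j ∉ S, y j = 0) :
    Continuous (imShift F y) := by
  rw [← isOpenQuotientMap_toTorus.continuous_comp_iff]
  have : imShift F y ∘ toTorus = fun x => F (complexPoint x y) :=
    funext fun x => hF.imShift_toTorus hy hS x
  rw [this]
  refine hF.continuousOn.comp_continuous ?_ fun x => complexPoint_mem_tube hy x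
  unfold complexPoint
  fun_prop

theorem IsAnalyticExtension.imShift_zero (hF : IsAnalyticExtension η σ F f) :
    imShift F 0 = f := by
  ext θ
  have := hF.eq_of_real (liftReal θ)
  rw [toTorus_liftReal] at this
  rw [← this, imShift]
  congr 1
  ext j
  simp [complexPoint]

/-- The integral over a period of a periodic holomorphic function does not depend on the height. -/
theorem integral_period_eq_of_differentiableOn_strip {g : ℂ → E} {r : ℝ}
    (hg : DifferentiableOn ℂ g {s | |s.im| < r}) (hper : ∀ s : ℂ, |s.im| < r → g (s + 1) = g s)
    {y y' : ℝ} (hy : |y| < r) (hy' : |y'| < r) (x : ℝ) :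
    ∫ t in (0 : ℝ)..1, g ((x + t : ℝ) + y * Complex.I)
      = ∫ t in (0 : ℝ)..1, g ((x + t : ℝ) + y' * Complex.I) := by
  have hsub : ∀ s ∈ Set.uIcc y y', |s| < r := by
    intro s hs
    rw [abs_lt] at *
    exact (convex_Ioo (-r) r).ordConnected.uIcc_subset hy hy' hs
  have h := Complex.integral_boundary_rect_eq_zero_of_differentiableOn g
    ((x : ℂ) + y * Complex.I) ((x + 1 : ℝ) + y' * Complex.I) (hg.mono fun s hs => hsub _ (by
      simpa using hs.2))
  simp only [Complex.add_re, Complex.ofReal_re, Complex.mul_re, Complex.I_re, mul_zero,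
    Complex.ofReal_im, Complex.I_im, mul_one, sub_self, add_zero, Complex.add_im, Complex.mul_im,
    zero_add] at h
  -- In Cauchy's theorem on the rectangle the two vertical sides differ by a period and cancel.
  have hside : ∫ s in y..y', g ((x + 1 : ℝ) + s * Complex.I)
      = ∫ s in y..y', g (x + s * Complex.I) := by
    refine intervalIntegral.integral_congr fun s hs => ?_
    rw [← hper (x + s * Complex.I) (by simpa using hsub s hs)]
    congr 1
    push_cast
    ring
  rw [hside, add_sub_cancel_right, sub_eq_zero] at h
  have h1 := intervalIntegral.integral_comp_add_left (a := 0) (b := 1)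
    (fun u : ℝ => g (u + y * Complex.I)) x
  have h2 := intervalIntegral.integral_comp_add_left (a := 0) (b := 1)
    (fun u : ℝ => g (u + y' * Complex.I)) x
  rw [add_zero] at h1 h2
  rw [h1, h2, h]

/-- Shift of the contour in finitely many variables. -/
theorem IsAnalyticExtension.integral_imShift [CompleteSpace E] (hF : IsAnalyticExtension η σ F f)
    (S : Finset ℕ) : ∀ {y : ℕ → ℝ}, (∀ j, |y j| < σ * bracket j ^ η) → (∀ j ∉ S, y j = 0) →
    ∫ θ, imShift F y θ ∂torusMeasure = ∫ θ, f θ ∂torusMeasure := by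
  induction S using Finset.induction_on with
  | empty =>
    intro y _ hS
    obtain rfl : y = 0 := funext fun j => hS j (by simp)
    rw [hF.imShift_zero]
  | insert a S _ ih =>
    intro y hy hS
    set y' := Function.update y a 0 with hy'
    have hr : 0 < σ * bracket a ^ η := (abs_nonneg _).trans_lt (hy a)
    have hyb : ∀ j, |y' j| < σ * bracket j ^ η := fun j => by
      rcases eq_or_ne j a with rfl | h
      · simpa [hy'] using hr
      · simpa [hy', h] using hy j
    have hyS : ∀ j ∉ S, y' j = 0 := fun j hj => by
      rcases eq_or_ne j a with rfl | h
      · simp [hy']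
      · simpa [hy', h] using hS j (by simp [h, hj])
    have hyS' : ∀ j ∉ insert a S, y' j = 0 := fun j hj => hyS j fun h => hj (by simp [h])
    -- Only the height of coordinate `a` is lowered to `0`. After averaging in that coordinate, both
    -- integrands are period integrals of one holomorphic function `g` at two heights.
    rw [← ih hyb hyS, integral_eq_integral_average (hF.continuous_imShift hy hS) a,
      integral_eq_integral_average (hF.continuous_imShift hyb hyS) a]
    refine integral_congr_ae (ae_of_all _ fun θ => ?_)
    set x := liftReal θ
    set g : ℂ → E := fun s => F (Function.update (complexPoint x y) a s) with hg
    have hpt : ∀ (v : ℕ → ℝ), (∀ j, j ≠ a → v j = y j) → (∀ j, |v j| < σ * bracket j ^ η) →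
        (∀ j ∉ insert a S, v j = 0) → ∀ t : ℝ,
        imShift F v (θ + toTorus (Pi.single a t)) = g ((x a + t : ℝ) + v a * Complex.I) := by
      intro v hv hvb hvS t
      rw [← toTorus_liftReal θ, ← toTorus_add, hF.imShift_toTorus hvb hvS]
      simp only [hg]
      congr 1
      ext j
      rcases eq_or_ne j a with rfl | h
      · simp [complexPoint, x]
      · simp [complexPoint, x, h, hv j h]
    simp only [hpt y (fun _ _ => rfl) hy hS, hpt y' (fun j hj => by simp [hy', hj]) hyb hyS']
    refine integral_period_eq_of_differentiableOn_strip
      (hF.separatelyHolomorphic.differentiableOn_slice (complexPoint_mem_tube hy x) a)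
      (fun s hs => ?_) (hy a) (hyb a) (x a)
    rw [← hF.add_int (update_mem_tube (complexPoint_mem_tube hy x) hs) (insert a S)
      (fun j hj => ?_) (Pi.single a 1)]
    · congr 1
      ext j
      rcases eq_or_ne j a with rfl | h
      · simp
      · simp [h]
    · have hja : j ≠ a := fun h => hj (by simp [h])
      simpa [hja] using hS j hj

/-- By Tychonoff the product of the closed rectangles of half the height of the tube is compact, and
`F` is continuous for the product topology. The bound is uniform in `y`, hence later in `k`. -/
theorem IsAnalyticExtension.exists_bound (hF : IsAnalyticExtension η σ F f) (hσ : 0 < σ) :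
    ∃ M : ℝ, ∀ y : ℕ → ℝ, (∀ j, |y j| ≤ σ / 2 * bracket j ^ η) → ∀ θ, ‖imShift F y θ‖ ≤ M := by
  have hK : IsCompact (Set.univ.pi fun j : ℕ =>
      Set.Icc (0 : ℝ) 1 ×ℂ Set.Icc (-(σ / 2 * bracket j ^ η)) (σ / 2 * bracket j ^ η)) :=
    isCompact_univ_pi fun j => isCompact_Icc.reProdIm isCompact_Icc
  obtain ⟨M, hM⟩ := hK.exists_bound_of_continuousOn (f := F) (hF.continuousOn.mono fun z hz j => by
    have h1 := abs_le.2 (hz j trivial).2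
    have h2 : 0 < bracket j ^ η := pow_pos (one_pos.trans_le (one_le_bracket j)) _
    exact h1.trans_lt (by nlinarith))
  refine ⟨M, fun y hy θ => hM _ fun j _ => ?_⟩
  rw [Complex.mem_reProdIm, complexPoint_re, complexPoint_im]
  exact ⟨liftReal_mem θ j, abs_le.1 (hy j)⟩

/-- The holomorphic character `z ↦ e^{2πi k·z}`. -/
noncomputable def complexCharacter (k : ℕ →₀ ℤ) (z : ℕ → ℂ) : ℂ :=
  k.prod fun j n => Complex.exp (2 * Real.pi * Complex.I * n * z j)

theorem complexCharacter_ofReal (k : ℕ →₀ ℤ) (x : ℕ → ℝ) :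
    complexCharacter k (fun j => (x j : ℂ)) = character k (toTorus x) := by
  refine Finset.prod_congr rfl fun j _ => ?_
  simp only [toTorus]
  rw [fourier_coe_apply]
  simp

theorem norm_complexCharacter (k : ℕ →₀ ℤ) (z : ℕ → ℂ) :
    ‖complexCharacter k z‖ = Real.exp (k.sum fun j n => -(2 * Real.pi * n * (z j).im)) := by
  rw [complexCharacter, Finsupp.prod, norm_prod, Finsupp.sum, Real.exp_sum]
  refine Finset.prod_congr rfl fun j _ => ?_
  rw [Complex.norm_exp]
  congr 1
  simp [Complex.mul_re, Complex.mul_im]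

/-- This makes the contour shift available for the integrand of a Fourier coefficient. -/
theorem IsAnalyticExtension.character_smul (hF : IsAnalyticExtension η σ F f) (k : ℕ →₀ ℤ) :
    IsAnalyticExtension η σ (fun z => complexCharacter k z • F z)
      (fun θ => character k θ • f θ) where
  continuousOn := by
    refine ContinuousOn.smul (Continuous.continuousOn ?_) hF.continuousOn
    unfold complexCharacter Finsupp.prod
    fun_prop
  separatelyHolomorphic z hz j := by
    refine DifferentiableAt.smul ?_ (hF.separatelyHolomorphic z hz j)
    unfold complexCharacter Finsupp.prod
    refine DifferentiableAt.fun_finsetProd fun i _ => ?_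
    rcases eq_or_ne i j with rfl | h
    · simp only [Function.update_self]
      fun_prop
    · simp only [Function.update_of_ne h]
      fun_prop
  eq_of_real x := by rw [complexCharacter_ofReal, hF.eq_of_real]

/-- Fourier coefficients of analytic functions decay exponentially in `|k|_η`. -/
theorem IsAnalyticNearTorus.exists_norm_fourierCoefficient_le [CompleteSpace E]
    (hf : IsAnalyticNearTorus η f) :
    ∃ a > 0, ∃ M : ℝ, ∀ k : ℕ →₀ ℤ,
      ‖fourierCoefficient f k‖ ≤ M * Real.exp (-a * etaNorm η k) := by
  obtain ⟨σ, hσ, F, hFc, hFd, hFr⟩ := hf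
  have hF : IsAnalyticExtension η σ F f := ⟨hFc, hFd, hFr⟩
  obtain ⟨M, hM⟩ := hF.exists_bound hσ
  refine ⟨Real.pi * σ, by positivity, M, fun k => ?_⟩
  -- At this height `|e^{-2πi k·z}| = e^{2π k·y} = e^{-πσ|k|_η}`; and `y` vanishes off the support
  -- of `k`, so only finitely many variables are shifted.
  set y : ℕ → ℝ := fun j => -(σ / 2 * bracket j ^ η * (k j).sign) with hy
  have hb : ∀ j, 0 < bracket j ^ η := fun j => pow_pos (one_pos.trans_le (one_le_bracket j)) _
  have hyb : ∀ j, |y j| ≤ σ / 2 * bracket j ^ η := fun j => by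
    have h1 : |((k j).sign : ℝ)| ≤ 1 := by
      rcases lt_trichotomy (k j) 0 with h | h | h
      · simp [Int.sign_eq_neg_one_of_neg h]
      · simp [h]
      · simp [Int.sign_eq_one_of_pos h]
    have := hb j
    rw [hy]
    simp only [abs_neg, abs_mul _ ((k j).sign : ℝ)]
    rw [abs_of_pos (by positivity)]
    exact mul_le_of_le_one_right (by positivity) h1
  have hyb' : ∀ j, |y j| < σ * bracket j ^ η := fun j =>
    (hyb j).trans_lt (by nlinarith [hb j])
  have hyS : ∀ j ∉ k.support, y j = 0 := fun j hj => by
    simp [hy, Finsupp.notMem_support_iff.1 hj]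
  rw [fourierCoefficient, ← (hF.character_smul (-k)).integral_imShift k.support hyb' hyS]
  refine (norm_integral_le_of_norm_le_const (C := M * Real.exp (-(Real.pi * σ) * etaNorm η k))
    (ae_of_all _ fun θ => ?_)).trans (by simp)
  rw [imShift, norm_smul, norm_complexCharacter, mul_comm]
  refine mul_le_mul (hM y hyb θ) (le_of_eq ?_) (Real.exp_pos _).le
    ((norm_nonneg _).trans (hM y hyb θ))
  congr 1
  rw [etaNorm, Finsupp.sum, Finsupp.sum, Finset.mul_sum, Finsupp.support_neg]
  refine Finset.sum_congr rfl fun j _ => ?_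
  have hs : ((k j).sign : ℝ) * (k j : ℝ) = |(k j : ℝ)| := by
    exact_mod_cast Int.sign_mul_self_eq_abs (k j)
  rw [complexPoint_im, ← hs]
  simp only [hy, Finsupp.coe_neg, Pi.neg_apply]
  push_cast
  ring

end Extension

/-! ### Characters along orbits and averages as Fourier multipliers -/

theorem character_toTorus (k : ℕ →₀ ℤ) (x : ℕ → ℝ) :
    character k (toTorus x) = Complex.exp (2 * Real.pi * Complex.I * pairing k x) := by
  rw [← complexCharacter_ofReal, complexCharacter, pairing, Finsupp.prod, Finsupp.sum,
    ← Complex.exp_sum]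
  push_cast
  rw [Finset.mul_sum]
  exact congrArg _ (Finset.sum_congr rfl fun j _ => by ring)

theorem character_toTorus_add (k : ℕ →₀ ℤ) (x : ℕ → ℝ) (θ : Torus) :
    character k (toTorus x + θ)
      = Complex.exp (2 * Real.pi * Complex.I * pairing k x) * character k θ := by
  rw [← toTorus_liftReal θ, ← toTorus_add, character_toTorus, character_toTorus, ← Complex.exp_add]
  have : pairing k (x + liftReal θ) = pairing k x + pairing k (liftReal θ) := by
    simp [pairing, Finsupp.sum, mul_add, Finset.sum_add_distrib]
  rw [this]
  push_cast
  ring_nf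

theorem norm_character (k : ℕ →₀ ℤ) (θ : Torus) : ‖character k θ‖ = 1 := by
  rw [← toTorus_liftReal θ, character_toTorus, mul_right_comm, Complex.norm_exp]
  simp

theorem character_rotation_iterate (k : ℕ →₀ ℤ) (ρ : ℕ → ℝ) (n : ℕ) (θ : Torus) :
    character k ((rotation ρ)^[n] θ)
      = Complex.exp (2 * Real.pi * Complex.I * pairing k ρ) ^ n * character k θ := by
  induction n with
  | zero => simp
  | succ n ih =>
    rw [Function.iterate_succ_apply', rotation, add_comm, character_toTorus_add, ih]
    ring

theorem pairing_zero (ρ : ℕ → ℝ) : pairing 0 ρ = 0 := Finsupp.sum_zero_index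

section Averages

variable {E : Type*} [NormedAddCommGroup E] [NormedSpace ℂ E] {f : Torus → E}

theorem fourierCoefficient_zero : fourierCoefficient f 0 = ∫ θ, f θ ∂torusMeasure := by
  simp [fourierCoefficient, character]

/-- The error of a Fourier multiplier that fixes constants and is controlled by powers of the small
divisors. -/
theorem norm_sub_integral_le {α : (ℕ →₀ ℤ) → ℂ} {θ : Torus} {A : E} {μ B : ℝ} {m : ℕ}
    (hA : HasSum (fun k => α k • character k θ • fourierCoefficient f k) A) (h0 : α 0 = 1)
    (hB : 0 ≤ B) (hα : ∀ k ≠ 0, ‖α k‖ ≤ B * bourgainDenominator μ k ^ m)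
    (hs : Summable fun k => ‖fourierCoefficient f k‖ * bourgainDenominator μ k ^ m) :
    ‖A - ∫ θ', f θ' ∂torusMeasure‖
      ≤ B * ∑' k, ‖fourierCoefficient f k‖ * bourgainDenominator μ k ^ m := by
  classical
  -- The integral of `f` is its zeroth mode, so subtracting it removes exactly the term `k = 0`.
  have h := hA.sub (hasSum_ite_eq (0 : ℕ →₀ ℤ) (∫ θ', f θ' ∂torusMeasure))
  rw [← h.tsum_eq]
  refine tsum_of_norm_bounded (hs.hasSum.mul_left B) fun k => ?_
  have hD : 0 < bourgainDenominator μ k := one_pos.trans_le (one_le_bourgainDenominator μ k)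
  rcases eq_or_ne k 0 with rfl | hk
  · have : character 0 θ = 1 := Finsupp.prod_zero_index
    rw [if_pos rfl, h0, this, one_smul, one_smul, fourierCoefficient_zero, sub_self, norm_zero]
    positivity
  · rw [if_neg hk, sub_zero, norm_smul, norm_smul, norm_character, one_mul]
    calc ‖α k‖ * ‖fourierCoefficient f k‖
        ≤ B * bourgainDenominator μ k ^ m * ‖fourierCoefficient f k‖ := by
          gcongr; exact hα k hk
      _ = _ := by ring

theorem hasSum_weightedBirkhoff
    (hf : ∀ θ, HasSum (fun k : ℕ →₀ ℤ => character k θ • fourierCoefficient f k) (f θ))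
    (w : ℝ → ℝ) (ρ : ℕ → ℝ) (N : ℕ) (θ : Torus) :
    HasSum (fun k => (((∑ n ∈ Finset.range N, w ((n : ℝ) / N) : ℝ) : ℂ)⁻¹ *
        ∑ n ∈ Finset.range N, (w ((n : ℝ) / N) : ℂ) *
          Complex.exp (2 * Real.pi * Complex.I * pairing k ρ) ^ n) •
        character k θ • fourierCoefficient f k) (weightedBirkhoff w ρ N f θ) := by
  unfold weightedBirkhoff
  refine (HasSum.const_smul _ (hasSum_sum fun n _ =>
    (hf ((rotation ρ)^[n] θ)).const_smul (w ((n : ℝ) / N) : ℂ))).congr_fun fun k => ?_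
  simp only [character_rotation_iterate, smul_smul, Finset.sum_mul, Finset.mul_sum,
    ← Finset.sum_smul, mul_assoc]

theorem weightedFlowAverage_eq_integral (w : ℝ → ℝ) (ρ : ℕ → ℝ) {T : ℝ} (hT : T ≠ 0) (θ : Torus) :
    weightedFlowAverage w ρ T f θ
      = ∫ s in (0 : ℝ)..1, (w s : ℂ) • f (toTorus (fun j => ρ j * (T * s)) + θ) := by
  have h := intervalIntegral.inv_smul_integral_comp_div (a := 0) (b := T)
    (fun s => (w s : ℂ) • f (toTorus (fun j => ρ j * (T * s)) + θ)) T
  simp only [mul_div_cancel₀ _ hT, zero_div, div_self hT] at h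
  rw [← h, weightedFlowAverage, ← Complex.ofReal_inv, Complex.coe_smul]

/-- After the substitution `t = Ts`, series and integral are exchanged by dominated convergence with
majorants `|w(s)| ‖f̂_k‖`; here absolute summability of the coefficients is needed. -/
theorem hasSum_weightedFlowAverage [CompleteSpace E]
    (hf : ∀ θ, HasSum (fun k : ℕ →₀ ℤ => character k θ • fourierCoefficient f k) (f θ))
    (hs : Summable fun k => ‖fourierCoefficient f k‖) {w : ℝ → ℝ}
    (hw : ContinuousOn w (Set.Icc 0 1)) (ρ : ℕ → ℝ) {T : ℝ} (hT : T ≠ 0) (θ : Torus) :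
    HasSum (fun k => (∫ s in (0 : ℝ)..1, (w s : ℂ) *
        Complex.exp (2 * Real.pi * Complex.I * (T * pairing k ρ : ℝ) * s)) •
        character k θ • fourierCoefficient f k) (weightedFlowAverage w ρ T f θ) := by
  rw [weightedFlowAverage_eq_integral w ρ hT]
  have hexp : ∀ (k : ℕ →₀ ℤ) (s : ℝ), character k (toTorus (fun j => ρ j * (T * s)) + θ)
      = Complex.exp (2 * Real.pi * Complex.I * (T * pairing k ρ : ℝ) * s) * character k θ := by
    intro k s
    rw [character_toTorus_add]
    have : pairing k (fun j => ρ j * (T * s)) = T * pairing k ρ * s := by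
      simp only [pairing, Finsupp.sum, Finset.mul_sum, Finset.sum_mul]
      exact Finset.sum_congr rfl fun j _ => by ring
    rw [this]
    push_cast
    ring_nf
  simp only [← intervalIntegral.integral_smul_const]
  have hwc : ContinuousOn (fun s => (w s : ℂ)) (Set.uIcc 0 1) := by
    rw [Set.uIcc_of_le zero_le_one]
    exact Complex.continuous_ofReal.comp_continuousOn hw
  refine intervalIntegral.hasSum_integral_of_dominated_convergence
    (fun k s => ‖(w s : ℂ)‖ * ‖fourierCoefficient f k‖) (fun k => ?_) (fun k => ?_) ?_ ?_ ?_
  · have hc : ContinuousOn (fun s : ℝ => ((w s : ℂ) * Complex.exp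
        (2 * Real.pi * Complex.I * (T * pairing k ρ : ℝ) * s)) •
        character k θ • fourierCoefficient f k) (Set.uIcc 0 1) :=
      (hwc.mul (by fun_prop)).smul continuousOn_const
    exact (hc.mono Set.uIoc_subset_uIcc).aestronglyMeasurable measurableSet_uIoc
  · refine ae_of_all _ fun s _ => le_of_eq ?_
    rw [norm_smul, norm_mul, norm_smul, norm_character, Complex.norm_exp]
    simp
  · exact ae_of_all _ fun s _ => hs.mul_left _
  · simp only [tsum_mul_left]
    exact (hwc.norm.mul continuousOn_const).intervalIntegrable
  · refine ae_of_all _ fun s _ => ?_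
    refine ((hf (toTorus (fun j => ρ j * (T * s)) + θ)).const_smul (w s : ℂ)).congr_fun fun k => ?_
    rw [hexp, smul_smul, smul_smul, mul_assoc]

end Averages

end AlmostPeriodic

/-! ### Conclusion: small divisors against exponential decay -/

open AlmostPeriodic in
theorem corollary2p11 {E : Type*} [NormedAddCommGroup E] [NormedSpace ℂ E] [CompleteSpace E]
    (η : ℕ) (hη : 2 ≤ η) (μ : ℝ) (hμ : 1 < μ) (γ : ℝ) (hγ : 0 < γ) (m : ℕ) (hm : 2 ≤ m)
    (w : ℝ → ℝ) (hw : AlmostPeriodic.IsWeight m w)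
    (Δ : ℝ → ℝ) (hΔ : AlmostPeriodic.IsApproximationFunction Δ)
    (f : AlmostPeriodic.Torus → E) (hf : AlmostPeriodic.MemB η Δ f)
    (hfa : AlmostPeriodic.IsAnalyticNearTorus η f) :
    ∃ C : ℝ, 0 < C ∧
      (∀ ρ : ℕ → ℝ, AlmostPeriodic.IsDiophantine γ μ ρ →
        ∀ N : ℕ, 1 ≤ N → ∀ θ : AlmostPeriodic.Torus,
          ‖AlmostPeriodic.weightedBirkhoff w ρ N f θ
              - ∫ θ', f θ' ∂AlmostPeriodic.torusMeasure‖ ≤ C / (N : ℝ) ^ m) ∧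
      (∀ ρ : ℕ → ℝ, AlmostPeriodic.IsDiophantineFlow γ μ ρ →
        ∀ T : ℝ, 1 ≤ T → ∀ θ : AlmostPeriodic.Torus,
          ‖AlmostPeriodic.weightedFlowAverage w ρ T f θ
              - ∫ θ', f θ' ∂AlmostPeriodic.torusMeasure‖ ≤ C / T ^ m) := by
  have hD : ∀ k, 1 ≤ bourgainDenominator μ k := one_le_bourgainDenominator μ
  obtain ⟨a, ha, M, hM⟩ := hfa.exists_norm_fourierCoefficient_le
  have hs : Summable fun k => ‖fourierCoefficient f k‖ * bourgainDenominator μ k ^ m := by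
    refine Summable.of_nonneg_of_le (fun k => ?_) (fun k => ?_)
      ((summable_exp_neg_etaNorm_mul_pow hη (zero_le_one.trans hμ.le) m ha).mul_left M)
    · have := one_pos.trans_le (hD k); positivity
    · rw [← mul_assoc]
      exact mul_le_mul_of_nonneg_right (hM k) (pow_nonneg (zero_le_one.trans (hD k)) m)
  have hs' : Summable fun k => ‖fourierCoefficient f k‖ :=
    Summable.of_nonneg_of_le (fun k => norm_nonneg _)
      (fun k => le_mul_of_one_le_right (norm_nonneg _) (one_le_pow₀ (hD k))) hs
  obtain ⟨K, hK0, hK⟩ := hw.exists_bound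
  obtain ⟨c, hc, hcN⟩ := hw.exists_le_sum
  set Q := ∑' k, ‖fourierCoefficient f k‖ * bourgainDenominator μ k ^ m with hQ
  have hQ0 : 0 ≤ Q := tsum_nonneg fun k => by have := one_pos.trans_le (hD k); positivity
  set I := ∫ θ', f θ' ∂torusMeasure with hI
  set C₁ := K * (m + 1) / (c * γ ^ m) * Q with hC₁
  set C₂ := K / γ ^ m * Q with hC₂
  have hC₁0 : 0 ≤ C₁ := by positivity
  have hC₂0 : 0 ≤ C₂ := by positivity
  -- The summand `1` ensures positivity, `‖I‖` is the error for `N = 1`, where the average is `0`,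
  -- and `C₁`, `C₂` serve the discrete case with `N ≥ 2` and the flow. None depends on `ρ`.
  refine ⟨1 + ‖I‖ + C₁ + C₂, by positivity, fun ρ hρ N hN θ => ?_, fun ρ hρ T hT θ => ?_⟩
  · rcases hN.eq_or_lt with rfl | hN2
    · have hw0 : w 0 = 0 := by simpa using hw.deriv_zero 0 (Nat.zero_le _)
      have : weightedBirkhoff w ρ 1 f θ = 0 := by simp [weightedBirkhoff, hw0]
      rw [this, zero_sub, norm_neg, Nat.cast_one, one_pow, div_one]
      linarith
    have hN0 : (0 : ℝ) < N := by exact_mod_cast hN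
    have hA := hcN N hN2
    have hA0 : 0 < ∑ n ∈ Finset.range N, w ((n : ℝ) / N) := lt_of_lt_of_le (by positivity) hA
    have h := norm_sub_integral_le (μ := μ) (m := m) (B := K * (m + 1) / (c * γ ^ m) / (N : ℝ) ^ m)
      (hasSum_weightedBirkhoff hf.hasSum w ρ N θ) ?_ (by positivity) (fun k hk => ?_) hs
    · refine h.trans ?_
      rw [div_mul_eq_mul_div]
      gcongr
      linarith [norm_nonneg I]
    · simp only [pairing_zero, Complex.ofReal_zero, mul_zero, Complex.exp_zero, one_pow, mul_one]
      rw [← Complex.ofReal_sum]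
      exact inv_mul_cancel₀ (by exact_mod_cast hA0.ne')
    · have hDk := one_pos.trans_le (hD k)
      have hb := hw.norm_sum_le hK hN (δ := γ / bourgainDenominator μ k) (by positivity)
        (fun n => (hρ k hk n).le)
      rw [norm_mul, norm_inv, Complex.norm_real, Real.norm_of_nonneg hA0.le]
      -- The factor `N` lost in the exponential sum cancels against `A_N ≥ cN`.
      calc _ ≤ (c * N)⁻¹ * (K * (m + 1) * N /
            ((N : ℝ) ^ m * (γ / bourgainDenominator μ k) ^ m)) := by gcongr
        _ = _ := by
          rw [div_pow]
          field_simp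
  · have hT0 : 0 < T := one_pos.trans_le hT
    have h := norm_sub_integral_le (μ := μ) (m := m) (B := K / γ ^ m / T ^ m)
      (hasSum_weightedFlowAverage hf.hasSum hs' hw.contDiffOn.continuousOn ρ hT0.ne' θ)
      ?_ (by positivity) (fun k hk => ?_) hs
    · refine h.trans ?_
      rw [div_mul_eq_mul_div]
      gcongr
      linarith [norm_nonneg I]
    · simp only [pairing_zero, mul_zero, Complex.ofReal_zero, zero_mul, Complex.exp_zero, mul_one]
      rw [intervalIntegral.integral_ofReal, hw.integral_eq_one, Complex.ofReal_one]
    · have hDk := one_pos.trans_le (hD k)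
      have hρk := hρ k hk
      have hp : 0 < |pairing k ρ| := lt_trans (by positivity) hρk
      refine (hw.norm_integral_le hK (mul_ne_zero hT0.ne' (abs_pos.1 hp))).trans ?_
      rw [abs_mul, abs_of_pos hT0, mul_pow]
      calc K / (T ^ m * |pairing k ρ| ^ m)
          ≤ K / (T ^ m * (γ / bourgainDenominator μ k) ^ m) := by gcongr
        _ = _ := by
          rw [div_pow]
          field_simp
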